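/- Let $2\le a\le b$ be integers, $p=ab$ and let $t\ge p$. A block array is a map $s:\{1,\dots,a\}\times\{1,\dots,b\}\to\{1,\dots,t\}$ assigning treatments to the plots of an $a\times b$ block, and $\mathcal S$ is the set of all block arrays. Consider the two-dimensional interference model, in which the response on a plot is the sum of an overall mean, a block effect, the direct effect of the treatment on that plot, the side effects of the treatments on its (at most four) row and column neighbours (the side effect of a treatment does not depend on the direction, and there are no guard plots or edge effects), and an error of mean zero; the errors have within-block covariance matrix $\Sigma=I_p$ and are uncorrelated between blocks. For $s\in\mathcal S$ let $T_s$ be the $p\times t$ plot–treatment incidence matrix and $F_s=MT_s$, where $M=(K_b\otimes I_a)+(K_b'\otimes I_a)+(I_b\otimes K_a)+(I_b\otimes K_a')$ and $K_h=(\mathbb 1[i-j=1])_{1\le i,j\le h}$. With $B_m=I_m-J_m/m$, where $J_m$ is the all-ones $m\times m$ matrix, put $$c_{s00}=\operatorname{tr}(B_tT_s'B_pT_s),\quad c_{s01}=\operatorname{tr}(B_tT_s'B_pF_s),\quad c_{s11}=\operatorname{tr}(B_tF_s'B_pF_s),\quad q_s(x)=c_{s00}+2c_{s01}x+c_{s11}x^2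 .$$ For a probability vector $\xi=(p_s)_{s\in\mathcal S}$ let $c_{\xi ij}=\sum_s p_sc_{sij}$, $q_\xi(x)=\sum_sp_sq_s(x)$ and $q^*_\xi=c_{\xi00}-c_{\xi01}^2/c_{\xi11}$ (if $c_{\xi11}=0$, then $c_{\xi01}=0$ and the quotient is read as $0$). Let $r(x)=\max_\xi q_\xi(x)$, let $x^*$ be the unique minimizer of $r$ on $\mathbb R$, let $y^*=\max_\xi q^*_\xi=r(x^*)$, and let $\mathcal Q=\{s\in\mathcal S: q_s(x^*)=y^*\}$. A treatment is significant in $s$ if it appears exactly twice, on two adjacent plots, at least one of which is a corner of the block; it is strictly significant if both plots are corners. Let $\mathcal Q_i$ be the set of block arrays with exactly $i$ significant treatments and exactly $ab-2i$ treatments replicated exactly once, and let $\mathcal Q_j^*\subset\mathcal Q_j$ consist of the arrays all of whose significant treatments are strictly significant. Put $$\eta=4p-2a-2b-\frac{2(8ab-7a-7b+4)}{t}+\frac{4(2p-a-b)^2}{pt}.$$ Then $x^*$ exists, $\max_\xi q_\xi^*=r(x^*)$, and the following hold. (I) If $a\ge3$, then $$x^*=\frac{(2p-5)-\sqrt{(2p-5)^2-24}}{12},$$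 which is irrational, $$y^*=p-\frac{p+2}{p}+2\Big(\frac{2a+2b-5}{p}-2\Big)x^*+\Big(\eta-\frac{16p-14a-14b+20}{p}\Big)x^{*2},\qquad \mathcal Q=\bigcup_{i=0}^4\mathcal Q_i .$$ (II) If $a=2$ and $b\ge3$, then $$x^*=\frac{b-1-\sqrt{(b-1)^2-1}}{2},\quad y^*=2b-1+\Big(\frac4b-6\Big)x^*+\Big(\eta-9+\frac{10}{b}\Big)x^{*2},\quad \mathcal Q=\mathcal Q_0\cup\mathcal Q_1^*\cup\mathcal Q_2^*.$$ (III) If $a=b=2$, then $x^*=\tfrac12$, $y^*=2$ and $\mathcal Q=\mathcal Q_0\cup\mathcal Q_1^*\cup\mathcal Q_2^*$. -/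

import Mathlib

open scoped Kronecker Matrix

noncomputable section

namespace Interference

/-- The plots of an `a × b` block. The plot in row `i` and column `j` is the pair `(j, i)`,
so that the Kronecker products `X ⊗ₖ Y` below have the column factor first. -/
abbrev Plot (a b : ℕ) : Type := Fin b × Fin a

/-- The set `𝒮` of block arrays: `s i j` is the treatment assigned to row `i`, column `j`. -/
abbrev BlockArray (a b t : ℕ) : Type := Fin a → Fin b → Fin t

/-- The treatment of the array `s` on the plot `u`. -/
def BlockArray.treat {a b t : ℕ} (s : BlockArray a b t) (u : Plot a b) : Fin t := s u.2 u.1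

/-! ### Design matrices and information matrices -/

/-- The shift matrix `K_h = (𝟙[i - j = 1])`. -/
def shiftK (h : ℕ) : Matrix (Fin h) (Fin h) ℝ :=
  Matrix.of fun i j => if (i : ℕ) = (j : ℕ) + 1 then 1 else 0

/-- The incidence matrix of the direct treatment effects. -/
def directMat {a b t : ℕ} (s : BlockArray a b t) : Matrix (Plot a b) (Fin t) ℝ :=
  Matrix.of fun u m => if s.treat u = m then 1 else 0

/-- The incidence matrix of the side effects from the four directions, without guard plots. -/
def sideMat {a b t : ℕ} (s : BlockArray a b t) : Matrix (Plot a b) (Fin t) ℝ :=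
  (((1 : Matrix (Fin b) (Fin b) ℝ) ⊗ₖ shiftK a) * directMat s)
    + (((1 : Matrix (Fin b) (Fin b) ℝ) ⊗ₖ (shiftK a)ᵀ) * directMat s)
    + ((shiftK b ⊗ₖ (1 : Matrix (Fin a) (Fin a) ℝ)) * directMat s)
    + (((shiftK b)ᵀ ⊗ₖ (1 : Matrix (Fin a) (Fin a) ℝ)) * directMat s)

/-- The all-ones square matrix. -/
def allOnes (ι : Type) : Matrix ι ι ℝ := Matrix.of fun _ _ => 1

/-- `B̃ = Σ⁻¹ - Σ⁻¹ J Σ⁻¹ (1' Σ⁻¹ 1)⁻¹` for a within-block covariance matrix `Σ`. -/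
def Btilde {a b : ℕ} (Sig : Matrix (Plot a b) (Plot a b) ℝ) : Matrix (Plot a b) (Plot a b) ℝ :=
  Sig⁻¹ - ((fun _ => (1 : ℝ)) ⬝ᵥ (Sig⁻¹ *ᵥ fun _ => (1 : ℝ)))⁻¹ •
    (Sig⁻¹ * allOnes (Plot a b) * Sig⁻¹)

/-- The centering matrix `B_t = I_t - J_t / t`. -/
def centering (t : ℕ) : Matrix (Fin t) (Fin t) ℝ := 1 - (t : ℝ)⁻¹ • allOnes (Fin t)

variable {a b t : ℕ}

/-- `C_{s00} = T' B̃ T`. -/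
def C00 (Sig : Matrix (Plot a b) (Plot a b) ℝ) (s : BlockArray a b t) :
    Matrix (Fin t) (Fin t) ℝ := (directMat s)ᵀ * Btilde Sig * directMat s

/-- `C_{s01} = T' B̃ F`. -/
def C01 (Sig : Matrix (Plot a b) (Plot a b) ℝ) (s : BlockArray a b t) :
    Matrix (Fin t) (Fin t) ℝ := (directMat s)ᵀ * Btilde Sig * sideMat s

/-- `C_{s11} = F' B̃ F`. -/
def C11 (Sig : Matrix (Plot a b) (Plot a b) ℝ) (s : BlockArray a b t) :
    Matrix (Fin t) (Fin t) ℝ := (sideMat s)ᵀ * Btilde Sig * sideMat s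

/-- `c_{s00} = tr (B_t C_{s00})`. -/
def c00 (Sig : Matrix (Plot a b) (Plot a b) ℝ) (s : BlockArray a b t) : ℝ :=
  (centering t * C00 Sig s).trace

/-- `c_{s01} = tr (B_t C_{s01})`. -/
def c01 (Sig : Matrix (Plot a b) (Plot a b) ℝ) (s : BlockArray a b t) : ℝ :=
  (centering t * C01 Sig s).trace

/-- `c_{s11} = tr (B_t C_{s11})`. -/
def c11 (Sig : Matrix (Plot a b) (Plot a b) ℝ) (s : BlockArray a b t) : ℝ :=
  (centering t * C11 Sig s).trace

/-- The quadratic function `q_s(x) = c_{s00} + 2 c_{s01} x + c_{s11} x²`. -/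
def q (Sig : Matrix (Plot a b) (Plot a b) ℝ) (s : BlockArray a b t) (x : ℝ) : ℝ :=
  c00 Sig s + 2 * c01 Sig s * x + c11 Sig s * x ^ 2

/-! ### Measures (approximate designs) -/

/-- The set `𝒫` of measures `ξ = (p_s)` on the block arrays. -/
abbrev DesignMeasure (a b t : ℕ) : Type := stdSimplex ℝ (BlockArray a b t)

/-- `q_ξ(x) = ∑ p_s q_s(x)`. -/
def qMeasure (Sig : Matrix (Plot a b) (Plot a b) ℝ) (ξ : DesignMeasure a b t) (x : ℝ) : ℝ :=
  ∑ s, ξ.1 s * q Sig s x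

/-- `q*_ξ = c_{ξ00} - c_{ξ01}² / c_{ξ11}`, where `c_{ξij} = ∑ p_s c_{sij}`. If `c_{ξ11} = 0` then
also `c_{ξ01} = 0`, and the quotient is read as `0`, so `q*_ξ` is always the minimum of `q_ξ`. -/
def qStar (Sig : Matrix (Plot a b) (Plot a b) ℝ) (ξ : DesignMeasure a b t) : ℝ :=
  (∑ s, ξ.1 s * c00 Sig s) - (∑ s, ξ.1 s * c01 Sig s) ^ 2 / (∑ s, ξ.1 s * c11 Sig s)

/-- `r(x) = max_ξ q_ξ(x)` (a maximum of a continuous function over a compact simplex). -/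
def r (a b t : ℕ) (Sig : Matrix (Plot a b) (Plot a b) ℝ) (x : ℝ) : ℝ :=
  ⨆ ξ : DesignMeasure a b t, qMeasure Sig ξ x

/-- `x` is `x*`, `y` is `y*` and `Q` is the supporting set: `x` is the unique minimizer of `r`,
`y` is the maximum of `q*_ξ` over all measures as well as the value `r(x)`, and `Q` consists of
the arrays `s` with `q_s(x) = y`. -/
structure IsOptimalTriple (Sig : Matrix (Plot a b) (Plot a b) ℝ) (x y : ℝ)
    (Q : Set (BlockArray a b t)) : Prop where
  minimizer : ∀ x' : ℝ, x' ≠ x → r a b t Sig x < r a b t Sig x'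
  value_eq : y = r a b t Sig x
  value_max : IsGreatest (Set.range fun ξ : DesignMeasure a b t => qStar Sig ξ) y
  support : Q = {s | q Sig s x = y}

/-! ### Significant treatments -/

/-- Two plots are adjacent if they are consecutive in a row or in a column. -/
def Adjacent (u v : Plot a b) : Prop :=
  (u.1 = v.1 ∧ ((u.2 : ℕ) + 1 = v.2 ∨ (v.2 : ℕ) + 1 = u.2)) ∨
  (u.2 = v.2 ∧ ((u.1 : ℕ) + 1 = v.1 ∨ (v.1 : ℕ) + 1 = u.1))

/-- A plot on a corner of the block. -/
def IsCorner (u : Plot a b) : Prop :=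
  ((u.2 : ℕ) = 0 ∨ (u.2 : ℕ) + 1 = a) ∧ ((u.1 : ℕ) = 0 ∨ (u.1 : ℕ) + 1 = b)

/-- `f_{s,m}`: the number of replications of the treatment `m` in the array `s`. -/
def replications (s : BlockArray a b t) (m : Fin t) : ℕ := {u : Plot a b | s.treat u = m}.ncard

/-- The treatment `m` appears exactly twice, in adjacent plots, at least one being a corner. -/
def IsSignificant (s : BlockArray a b t) (m : Fin t) : Prop :=
  replications s m = 2 ∧
  (∃ u v : Plot a b, s.treat u = m ∧ s.treat v = m ∧ Adjacent u v) ∧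
  ∃ u : Plot a b, s.treat u = m ∧ IsCorner u

/-- The treatment `m` is significant and all of its plots are corners. -/
def IsStrictlySignificant (s : BlockArray a b t) (m : Fin t) : Prop :=
  IsSignificant s m ∧ ∀ u : Plot a b, s.treat u = m → IsCorner u

/-- `𝒬_i`: exactly `i` treatments are significant and `ab - 2i` are replicated exactly once. -/
def QSet (a b t i : ℕ) : Set (BlockArray a b t) :=
  {s | {m : Fin t | IsSignificant s m}.ncard = i ∧
    {m : Fin t | replications s m = 1}.ncard + 2 * i = a * b}

/-- `𝒬*_j`: the arrays of `𝒬_j` whose significant treatments are all strictly significant. -/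
def QStarSet (a b t j : ℕ) : Set (BlockArray a b t) :=
  {s | s ∈ QSet a b t j ∧ ∀ m : Fin t, IsSignificant s m → IsStrictlySignificant s m}

/-- The constant `η` (with `p = ab`). -/
def eta (a b t : ℕ) : ℝ :=
  4 * (a * b) - 2 * a - 2 * b - 2 * (8 * a * b - 7 * a - 7 * b + 4) / t
    + 4 * (2 * (a * b) - a - b) ^ 2 / (a * b * t)

end Interference

end

/-!
Let `A` be the adjacency matrix of the grid of plots and `K_x = (I + xA) B_p (I + xA)`. Since the
errors are uncorrelated, `q_s(x) = ∑_{v,w} (1[s_v = s_w] - 1/t) K_x(v, w)`, so `q_s(x)` is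
independent of `s` up to the sum of `K_x(v, w)` over the ordered pairs `v ≠ w` that carry
the same treatment. For adjacent plots `K_x(v, w) = 2x - (1 + x d_v)(1 + x d_w) / p`, where `d` is
the number of neighbours, and for other pairs `K_x(v, w) < 0` as long as `0 ≤ x ≤ 2 / p`. The
product of degrees is smallest at the corners, so at the smaller root `x*` of
`(1 + 2x)(1 + δx) = 2px`, with `δ` the smallest degree of a neighbour of a corner, the kernel
vanishes at the significant pairs (the strictly significant ones if `δ = 2`) and is negative at all
other pairs. Hence the arrays maximizing `q_s(x*)` are those that repeat treatments only at these
pairs. Among them, an array with distinct treatments has nonpositive slope at `x*` and an array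
with two significant treatments has nonnegative slope, so a mixture of the two has its minimum at
`x*`, which gives the saddle point.
-/

noncomputable section

namespace Interference

/-! ### Real quadratics -/

theorem sq_le_mul_of_quadratic_nonneg {α β γ : ℝ} (h : ∀ x : ℝ, 0 ≤ α + 2 * β * x + γ * x ^ 2) :
    β ^ 2 ≤ α * γ := by
  have hdiscrim : discrim γ (2 * β) α ≤ 0 := discrim_le_zero fun x => by linarith [h x]
  rw [discrim] at hdiscrim
  linarith

theorem leadingCoeff_nonneg_of_quadratic_nonneg {α β γ : ℝ}
    (h : ∀ x : ℝ, 0 ≤ α + 2 * β * x + γ * x ^ 2) : 0 ≤ γ := by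
  by_contra! hγ
  have hα : 0 ≤ α := by simpa using h 0
  have hβγ := sq_le_mul_of_quadratic_nonneg h
  have hβ : β = 0 := pow_eq_zero_iff two_ne_zero |>.1 <|
    le_antisymm (hβγ.trans (mul_nonpos_of_nonneg_of_nonpos hα hγ.le)) (sq_nonneg β)
  have hα' : α = 0 := by
    rw [hβ] at hβγ
    nlinarith
  have h1 := h 1
  rw [hα', hβ] at h1
  linarith

theorem sub_sq_div_le_quadratic {α β γ : ℝ} (h : ∀ x : ℝ, 0 ≤ α + 2 * β * x + γ * x ^ 2) (x : ℝ) :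
    α - β ^ 2 / γ ≤ α + 2 * β * x + γ * x ^ 2 := by
  rcases (leadingCoeff_nonneg_of_quadratic_nonneg h).eq_or_lt with hγ | hγ
  · have hβ : β = 0 := pow_eq_zero_iff two_ne_zero |>.1 <|
      le_antisymm (by simpa [← hγ] using sq_le_mul_of_quadratic_nonneg h) (sq_nonneg β)
    simp [← hγ, hβ]
  · have hsq : α + 2 * β * x + γ * x ^ 2 - (α - β ^ 2 / γ) = (β + γ * x) ^ 2 / γ := by
      field_simp
      ring
    rw [← sub_nonneg, hsq]
    positivity

/-- The smaller root of `α x ^ 2 - β x + γ`, for `α > 0` and a nonnegative discriminant. The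
minimizers `x*` of the theorem are of this form. -/
def smallerRoot (α β γ : ℝ) : ℝ := (β - √(β ^ 2 - 4 * α * γ)) / (2 * α)

section SmallerRoot

variable {α β γ z : ℝ}

theorem sq_le_discrim_of_quadratic_nonpos (hα : 0 < α) (hz : α * z ^ 2 - β * z + γ ≤ 0) :
    (β - 2 * α * z) ^ 2 ≤ β ^ 2 - 4 * α * γ := by
  nlinarith

theorem smallerRoot_le (hα : 0 < α) (hz : α * z ^ 2 - β * z + γ ≤ 0) :
    smallerRoot α β γ ≤ z := by
  have h := (le_abs_self _).trans
    (Real.abs_le_sqrt (sq_le_discrim_of_quadratic_nonpos hα hz))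
  rw [smallerRoot, div_le_iff₀ (by positivity)]
  linarith

theorem quadratic_smallerRoot (hα : 0 < α) (hz : α * z ^ 2 - β * z + γ ≤ 0) :
    α * smallerRoot α β γ ^ 2 - β * smallerRoot α β γ + γ = 0 := by
  have hsq := Real.sq_sqrt ((sq_nonneg _).trans (sq_le_discrim_of_quadratic_nonpos hα hz))
  rw [smallerRoot]
  generalize √(β ^ 2 - 4 * α * γ) = w at hsq ⊢
  field_simp
  linear_combination hsq

theorem smallerRoot_pos (hα : 0 < α) (hβ : 0 < β) (hγ : 0 < γ) : 0 < smallerRoot α β γ := by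
  have h : √(β ^ 2 - 4 * α * γ) < β := by
    rw [Real.sqrt_lt' hβ]
    linarith [mul_pos hα hγ]
  exact div_pos (sub_pos.2 h) (by positivity)

end SmallerRoot

theorem quadratic_inv_nonpos_of_six_le {p : ℝ} (hp : 6 ≤ p) :
    6 * p⁻¹ ^ 2 - (2 * p - 5) * p⁻¹ + 1 ≤ 0 := by
  have hp0 : p ≠ 0 := by positivity
  calc 6 * p⁻¹ ^ 2 - (2 * p - 5) * p⁻¹ + 1 = -((p - 6) * (p + 1)) / p ^ 2 := by
        field_simp
        ring
    _ ≤ 0 := div_nonpos_of_nonpos_of_nonneg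
        (neg_nonpos.2 (mul_nonneg (by linarith) (by linarith))) (sq_nonneg p)

theorem quadratic_inv_nonpos_of_three_le {b : ℝ} (hb : 3 ≤ b) :
    1 * (2 * b)⁻¹ ^ 2 - (b - 1) * (2 * b)⁻¹ + 1 / 4 ≤ 0 := by
  have hb0 : b ≠ 0 := by positivity
  calc 1 * (2 * b)⁻¹ ^ 2 - (b - 1) * (2 * b)⁻¹ + 1 / 4
      = -((b - 3) * (b + 1) + 2) / (4 * b ^ 2) := by
        field_simp
        ring
    _ ≤ 0 := div_nonpos_of_nonpos_of_nonneg
        (neg_nonpos.2 (add_nonneg (mul_nonneg (by linarith) (by linarith)) zero_le_two))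
        (by positivity)

theorem not_isSquare_sq_sub {m k : ℕ} (hk : 0 < k) (hkm : k + 2 ≤ 2 * m) :
    ¬ IsSquare (m ^ 2 - k) := by
  rintro ⟨n, hn⟩
  have hk2 : k ≤ m ^ 2 := by nlinarith
  have hsq : n * n + k = m ^ 2 := by omega
  have hlt : n < m := by nlinarith
  nlinarith [Nat.mul_le_mul hlt hlt]

theorem irrational_smallerRoot_of_nine_le {p : ℕ} (hp : 9 ≤ p) :
    Irrational (smallerRoot 6 (2 * p - 5) 1) := by
  have hsqrt := irrational_sqrt_natCast_iff.2 (not_isSquare_sq_sub (m := 2 * p - 5) (k := 24)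
    (by norm_num) (by omega))
  have h := (hsqrt.natCast_sub (2 * p - 5)).div_natCast (m := 12) (by norm_num)
  convert h using 1
  have h24 : 24 ≤ (2 * p - 5) ^ 2 := (by norm_num : 24 ≤ 13 ^ 2).trans
    (Nat.pow_le_pow_left (by omega) 2)
  have h5 : 5 ≤ 2 * p := by omega
  rw [smallerRoot]
  push_cast [h24, h5]
  norm_num

/-! ### Saddle points from stationary mixtures -/

section Optimality

variable {a b t : ℕ} {Sig : Matrix (Plot a b) (Plot a b) ℝ} {x y : ℝ}

theorem qMeasure_eq (ξ : DesignMeasure a b t) (x : ℝ) :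
    qMeasure Sig ξ x = (∑ s, ξ.1 s * c00 Sig s) + 2 * (∑ s, ξ.1 s * c01 Sig s) * x
      + (∑ s, ξ.1 s * c11 Sig s) * x ^ 2 := by
  simp only [qMeasure, q, Finset.mul_sum, Finset.sum_mul, ← Finset.sum_add_distrib]
  exact Finset.sum_congr rfl fun s _ => by ring

theorem qMeasure_le (hle : ∀ s : BlockArray a b t, q Sig s x ≤ y) (ξ : DesignMeasure a b t) :
    qMeasure Sig ξ x ≤ y := by
  calc qMeasure Sig ξ x ≤ ∑ s, ξ.1 s * y :=
        Finset.sum_le_sum fun s _ => mul_le_mul_of_nonneg_left (hle s) (ξ.2.1 s)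
    _ = y := by rw [← Finset.sum_mul, ξ.2.2, one_mul]

theorem qMeasure_le_r (ξ : DesignMeasure a b t) (x : ℝ) : qMeasure Sig ξ x ≤ r a b t Sig x := by
  obtain ⟨y, hy⟩ := (Set.finite_range fun s : BlockArray a b t => q Sig s x).bddAbove
  refine le_ciSup (f := fun ξ : DesignMeasure a b t => qMeasure Sig ξ x) ⟨y, ?_⟩ ξ
  rintro _ ⟨ζ, rfl⟩
  exact qMeasure_le (fun s => hy (Set.mem_range_self s)) ζ

theorem qStar_le_qMeasure (hq : ∀ (s : BlockArray a b t) (x : ℝ), 0 ≤ q Sig s x)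
    (ξ : DesignMeasure a b t) (x : ℝ) : qStar Sig ξ ≤ qMeasure Sig ξ x := by
  have hnonneg : ∀ x, 0 ≤ qMeasure Sig ξ x := fun x =>
    Finset.sum_nonneg fun s _ => mul_nonneg (ξ.2.1 s) (hq s x)
  simp only [qMeasure_eq] at hnonneg ⊢
  exact sub_sq_div_le_quadratic hnonneg x

theorem isOptimalTriple_of_measure (hq : ∀ (s : BlockArray a b t) (x : ℝ), 0 ≤ q Sig s x)
    (hle : ∀ s : BlockArray a b t, q Sig s x ≤ y) (ξ : DesignMeasure a b t)
    (hξ : qMeasure Sig ξ x = y) (hc11 : 0 < ∑ s, ξ.1 s * c11 Sig s)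
    (hstationary : (∑ s, ξ.1 s * c01 Sig s) + (∑ s, ξ.1 s * c11 Sig s) * x = 0) :
    IsOptimalTriple Sig x y {s : BlockArray a b t | q Sig s x = y} := by
  have hr : r a b t Sig x = y := by
    have : Nonempty (DesignMeasure a b t) := ⟨ξ⟩
    exact le_antisymm (ciSup_le (qMeasure_le hle)) (hξ ▸ qMeasure_le_r ξ x)
  have hc01 : ∑ s, ξ.1 s * c01 Sig s = -((∑ s, ξ.1 s * c11 Sig s) * x) :=
    eq_neg_of_add_eq_zero_left hstationary
  refine ⟨fun x' hx' => ?_, hr.symm, ⟨⟨ξ, ?_⟩, ?_⟩, rfl⟩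
  · have hparabola : qMeasure Sig ξ x' = y + (∑ s, ξ.1 s * c11 Sig s) * (x' - x) ^ 2 := by
      rw [← hξ, qMeasure_eq, qMeasure_eq, hc01]
      ring
    have hsq : 0 < (x' - x) ^ 2 := sq_pos_iff.2 (sub_ne_zero.2 hx')
    rw [hr]
    exact (hparabola ▸ lt_add_of_pos_right y (mul_pos hc11 hsq)).trans_le (qMeasure_le_r ξ x')
  · change qStar Sig ξ = y
    rw [← hξ, qMeasure_eq, qStar, hc01]
    field_simp
    ring
  · rintro _ ⟨ζ, rfl⟩
    exact (qStar_le_qMeasure hq ζ x).trans (qMeasure_le hle ζ)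

theorem c11_pos {s : BlockArray a b t} (hq : ∀ x, 0 ≤ q Sig s x) (hs : c01 Sig s ≠ 0) :
    0 < c11 Sig s := by
  refine (leadingCoeff_nonneg_of_quadratic_nonneg hq).lt_of_ne' fun h => ?_
  have hle := sq_le_mul_of_quadratic_nonneg hq
  rw [h, mul_zero] at hle
  exact hs (pow_eq_zero_iff two_ne_zero |>.1 (le_antisymm hle (sq_nonneg _)))

theorem exists_designMeasure_sum_eq (s₀ s₁ : BlockArray a b t) {μ ν : ℝ} (hμ : 0 ≤ μ) (hν : 0 ≤ ν)
    (hμν : μ + ν = 1) :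
    ∃ ξ : DesignMeasure a b t, ∀ f : BlockArray a b t → ℝ,
      ∑ s, ξ.1 s * f s = μ * f s₀ + ν * f s₁ := by
  refine ⟨⟨μ • Pi.single s₀ 1 + ν • Pi.single s₁ 1, convex_stdSimplex ℝ _
    (single_mem_stdSimplex ℝ s₀) (single_mem_stdSimplex ℝ s₁) hμ hν hμν⟩, fun f => ?_⟩
  simp [add_mul, Finset.sum_add_distrib, Pi.single_apply]

theorem isOptimalTriple_of_slopes (hq : ∀ (s : BlockArray a b t) (x : ℝ), 0 ≤ q Sig s x)
    (hle : ∀ s : BlockArray a b t, q Sig s x ≤ y) {s₀ s₁ : BlockArray a b t}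
    (hs₀ : q Sig s₀ x = y) (hs₁ : q Sig s₁ x = y)
    (hc₀ : c01 Sig s₀ ≠ 0) (hc₁ : c01 Sig s₁ ≠ 0)
    (hslope₀ : c01 Sig s₀ + c11 Sig s₀ * x ≤ 0) (hslope₁ : 0 ≤ c01 Sig s₁ + c11 Sig s₁ * x) :
    IsOptimalTriple Sig x y {s : BlockArray a b t | q Sig s x = y} := by
  obtain ⟨μ, ν, hμ, hν, hμν, hzero⟩ : (0 : ℝ) ∈
      segment ℝ (c01 Sig s₀ + c11 Sig s₀ * x) (c01 Sig s₁ + c11 Sig s₁ * x) :=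
    Icc_subset_segment ⟨hslope₀, hslope₁⟩
  obtain ⟨ξ, hξ⟩ := exists_designMeasure_sum_eq s₀ s₁ hμ hν hμν
  refine isOptimalTriple_of_measure hq hle ξ ?_ ?_ ?_
  · rw [qMeasure, hξ, hs₀, hs₁, ← add_mul, hμν, one_mul]
  · rw [hξ]
    exact convex_Ioi (0 : ℝ) (c11_pos (hq s₀) hc₀) (c11_pos (hq s₁) hc₁) hμ hν hμν
  · rw [hξ, hξ]
    simp only [smul_eq_mul] at hzero
    linear_combination hzero

end Optimality

/-! ### The interference kernel of a graph -/

section MeanCentering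

theorem allOnes_eq_vecMulVec (ι : Type) : allOnes ι = Matrix.vecMulVec 1 1 := by
  ext i j
  simp [allOnes, Matrix.vecMulVec_apply]

variable {ι : Type} [Fintype ι] [DecidableEq ι]

variable (ι) in
/-- The orthogonal projection `I - J / n` that subtracts from a vector on `n` points its mean. Both
`B_t` and, for uncorrelated errors, `B̃` are of this form. -/
def meanCentering : Matrix ι ι ℝ := 1 - (Fintype.card ι : ℝ)⁻¹ • allOnes ι

theorem centering_eq_meanCentering (t : ℕ) : centering t = meanCentering (Fin t) := by
  rw [centering, meanCentering, Fintype.card_fin]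

theorem Btilde_one (a b : ℕ) :
    Btilde (1 : Matrix (Plot a b) (Plot a b) ℝ) = meanCentering (Plot a b) := by
  simp [Btilde, meanCentering, dotProduct]

variable (ι) in
theorem transpose_meanCentering : (meanCentering ι)ᵀ = meanCentering ι := by
  rw [meanCentering, allOnes_eq_vecMulVec, Matrix.transpose_sub, Matrix.transpose_one,
    Matrix.transpose_smul, Matrix.transpose_vecMulVec]

variable (ι) in
theorem meanCentering_mul_self : meanCentering ι * meanCentering ι = meanCentering ι := by
  have hJ : allOnes ι * allOnes ι = (Fintype.card ι : ℝ) • allOnes ι := by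
    ext i j
    simp [allOnes, Matrix.mul_apply]
  have hn : (Fintype.card ι : ℝ)⁻¹ * ((Fintype.card ι : ℝ)⁻¹ * Fintype.card ι)
      = (Fintype.card ι : ℝ)⁻¹ := by
    simpa only [inv_inv, mul_assoc, mul_comm (Fintype.card ι : ℝ)] using
      mul_inv_mul_cancel (Fintype.card ι : ℝ)⁻¹
  simp only [meanCentering, Matrix.mul_sub, Matrix.sub_mul, Matrix.one_mul, Matrix.mul_one,
    Matrix.smul_mul, Matrix.mul_smul, hJ, smul_sub, smul_smul, hn, sub_self, sub_zero]

variable (ι) in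
theorem posSemidef_meanCentering : (meanCentering ι).PosSemidef := by
  have h := Matrix.posSemidef_conjTranspose_mul_self (meanCentering ι)
  rwa [Matrix.conjTranspose_eq_transpose_of_trivial, transpose_meanCentering,
    meanCentering_mul_self] at h

theorem mul_meanCentering_mul_transpose_apply {κ : Type} (M : Matrix κ ι ℝ) (i j : κ) :
    (M * meanCentering ι * Mᵀ) i j
      = (M * Mᵀ) i j - (M *ᵥ 1) i * (M *ᵥ 1) j / Fintype.card ι := by
  rw [meanCentering, allOnes_eq_vecMulVec, Matrix.mul_sub, Matrix.mul_one, Matrix.sub_mul,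
    Matrix.mul_smul, Matrix.smul_mul, Matrix.mul_vecMulVec, Matrix.vecMulVec_mul,
    Matrix.vecMul_transpose, Matrix.sub_apply, Matrix.smul_apply, Matrix.vecMulVec_apply,
    smul_eq_mul, inv_mul_eq_div]

theorem dotProduct_meanCentering_mulVec (u : ι → ℝ) :
    u ⬝ᵥ (meanCentering ι *ᵥ u) = ∑ i, u i ^ 2 - (∑ i, u i) ^ 2 / Fintype.card ι := by
  rw [meanCentering, allOnes_eq_vecMulVec, Matrix.sub_mulVec, Matrix.one_mulVec,
    Matrix.smul_mulVec, Matrix.vecMulVec_mulVec, dotProduct_sub, dotProduct_smul]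
  simp only [dotProduct, Pi.one_apply, one_mul, Pi.smul_apply, MulOpposite.smul_eq_mul_unop,
    MulOpposite.unop_op, ← Finset.sum_mul, smul_eq_mul, ← sq, inv_mul_eq_div]

end MeanCentering

section DistinctTreatments

variable {V : Type} [Fintype V] (G : SimpleGraph V) [DecidableRel G.Adj]

/-- The coefficient of `x ^ 2` in `distinctQ`. -/
def distinctC11 (t : ℕ) : ℝ :=
  ∑ v, (G.degree v : ℝ) - (∑ v, (G.degree v : ℝ) ^ 2) / Fintype.card V
    - (∑ v, (G.degree v : ℝ) ^ 2 - (∑ v, (G.degree v : ℝ)) ^ 2 / Fintype.card V) / t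

/-- The value `q_s(x)` for an array `s` without repeated treatments, on any graph of plots. -/
def distinctQ (t : ℕ) (x : ℝ) : ℝ :=
  (Fintype.card V - 1) + 2 * (-(∑ v, (G.degree v : ℝ)) / Fintype.card V) * x
    + distinctC11 G t * x ^ 2

theorem distinctC11_le (t : ℕ) : distinctC11 G t ≤ ∑ v, (G.degree v : ℝ) := by
  classical
  have hvar : 0 ≤ ∑ v, (G.degree v : ℝ) ^ 2 - (∑ v, (G.degree v : ℝ)) ^ 2 / Fintype.card V := by
    rw [← dotProduct_meanCentering_mulVec]
    simpa using (posSemidef_meanCentering V).dotProduct_mulVec_nonneg fun v => (G.degree v : ℝ)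
  have hmean : 0 ≤ (∑ v, (G.degree v : ℝ) ^ 2) / Fintype.card V := by positivity
  rw [distinctC11]
  linarith [div_nonneg hvar t.cast_nonneg]

end DistinctTreatments

section Kernel

variable {V : Type} [DecidableEq V] (G : SimpleGraph V) [DecidableRel G.Adj] {x : ℝ}

variable (x) in
theorem isSymm_one_add_smul_adjMatrix : (1 + x • G.adjMatrix ℝ).IsSymm := by
  rw [Matrix.IsSymm, Matrix.transpose_add, Matrix.transpose_one, Matrix.transpose_smul,
    SimpleGraph.transpose_adjMatrix]

variable [Fintype V]

variable (x) in
theorem one_add_smul_adjMatrix_mulVec_one :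
    (1 + x • G.adjMatrix ℝ) *ᵥ 1 = fun v => 1 + x * G.degree v := by
  ext v
  simp [Matrix.add_mulVec, Matrix.smul_mulVec]

/-- The kernel `(I + x A) B (I + x A)`, for the adjacency matrix `A` of a graph of plots. The value
`q_s(x)` is the sum of its entries weighted by `1[s v = s w] - 1/t`. -/
def interferenceKernel (x : ℝ) : Matrix V V ℝ :=
  (1 + x • G.adjMatrix ℝ) * meanCentering V * (1 + x • G.adjMatrix ℝ)

theorem interferenceKernel_apply (x : ℝ) (v w : V) :
    interferenceKernel G x v w = (1 : Matrix V V ℝ) v w + 2 * x * G.adjMatrix ℝ v w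
      + x ^ 2 * (G.adjMatrix ℝ * G.adjMatrix ℝ) v w
      - (1 + x * G.degree v) * (1 + x * G.degree w) / Fintype.card V := by
  have hK := mul_meanCentering_mul_transpose_apply (1 + x • G.adjMatrix ℝ) v w
  rw [(isSymm_one_add_smul_adjMatrix G x).eq, one_add_smul_adjMatrix_mulVec_one] at hK
  rw [interferenceKernel, hK]
  simp only [Matrix.add_mul, Matrix.mul_add, Matrix.one_mul, Matrix.mul_one, Matrix.smul_mul,
    Matrix.mul_smul, Matrix.add_apply, Matrix.smul_apply, smul_eq_mul]
  ring

theorem sum_interferenceKernel [Nonempty V] (x : ℝ) :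
    ∑ v, ∑ w, interferenceKernel G x v w
      = (∑ v, (G.degree v : ℝ) ^ 2 - (∑ v, (G.degree v : ℝ)) ^ 2 / Fintype.card V) * x ^ 2 := by
  have hform : ∑ v, ∑ w, interferenceKernel G x v w
      = ((1 + x • G.adjMatrix ℝ) *ᵥ 1) ⬝ᵥ
        (meanCentering V *ᵥ ((1 + x • G.adjMatrix ℝ) *ᵥ 1)) := by
    calc ∑ v, ∑ w, interferenceKernel G x v w = 1 ⬝ᵥ (interferenceKernel G x *ᵥ 1) := by
          simp [dotProduct, Matrix.mulVec]
      _ = _ := by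
          rw [interferenceKernel, ← Matrix.mulVec_mulVec, ← Matrix.mulVec_mulVec,
            Matrix.dotProduct_mulVec, ← Matrix.mulVec_transpose,
            (isSymm_one_add_smul_adjMatrix G x).eq]
  rw [hform, one_add_smul_adjMatrix_mulVec_one, dotProduct_meanCentering_mulVec]
  simp only [add_sq, mul_pow, one_pow, mul_one, Finset.sum_add_distrib, ← Finset.mul_sum,
    Finset.sum_const, Finset.card_univ, nsmul_eq_mul]
  field_simp
  ring

theorem trace_interferenceKernel [Nonempty V] (x : ℝ) :
    (interferenceKernel G x).trace = (Fintype.card V - 1)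
      - 2 * ((∑ v, (G.degree v : ℝ)) / Fintype.card V) * x
      + (∑ v, (G.degree v : ℝ) - (∑ v, (G.degree v : ℝ) ^ 2) / Fintype.card V) * x ^ 2 := by
  have hdiag : ∀ v, interferenceKernel G x v v = 1 + x ^ 2 * G.degree v
      - (1 + x * G.degree v) * (1 + x * G.degree v) / Fintype.card V := by
    intro v
    rw [interferenceKernel_apply, SimpleGraph.adjMatrix_mul_self_apply_self, Matrix.one_apply_eq,
      SimpleGraph.adjMatrix_apply, if_neg (G.irrefl)]
    ring
  simp only [Matrix.trace, Matrix.diag_apply, hdiag, ← sq, add_sq, mul_pow, one_pow, mul_one,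
    Finset.sum_sub_distrib, Finset.sum_add_distrib, ← Finset.mul_sum, ← Finset.sum_div,
    Finset.sum_const, Finset.card_univ, nsmul_eq_mul]
  field_simp
  ring

variable {G}

theorem interferenceKernel_apply_of_adj {v w : V} (hvw : G.Adj v w)
    (htriangle : ∀ u, G.Adj v u → ¬ G.Adj u w) (x : ℝ) :
    interferenceKernel G x v w
      = 2 * x - (1 + x * G.degree v) * (1 + x * G.degree w) / Fintype.card V := by
  have hsq : (G.adjMatrix ℝ * G.adjMatrix ℝ) v w = 0 := by
    rw [SimpleGraph.adjMatrix_mul_apply]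
    refine Finset.sum_eq_zero fun u hu => ?_
    rw [SimpleGraph.adjMatrix_apply, if_neg (htriangle u ((G.mem_neighborFinset v u).1 hu))]
  rw [interferenceKernel_apply, hsq, Matrix.one_apply_ne hvw.ne, SimpleGraph.adjMatrix_apply,
    if_pos hvw]
  ring

theorem interferenceKernel_apply_neg_of_not_adj {v w : V} (hne : v ≠ w) (hvw : ¬ G.Adj v w)
    (hx : 0 ≤ x) (hx2 : Fintype.card V * x ≤ 2) : interferenceKernel G x v w < 0 := by
  have hcard : (0 : ℝ) < Fintype.card V := by exact_mod_cast Fintype.card_pos_iff.2 ⟨v⟩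
  set c := (G.adjMatrix ℝ * G.adjMatrix ℝ) v w with hc
  have hle_one : ∀ u u', G.adjMatrix ℝ u u' ≤ 1 := fun u u' => by
    rw [SimpleGraph.adjMatrix_apply]
    split_ifs <;> norm_num
  have hc0 : 0 ≤ c := by
    rw [hc, SimpleGraph.adjMatrix_mul_apply]
    refine Finset.sum_nonneg fun u _ => ?_
    rw [SimpleGraph.adjMatrix_apply]
    split_ifs <;> norm_num
  have hcv : c ≤ G.degree v := by
    rw [hc, SimpleGraph.adjMatrix_mul_apply, SimpleGraph.degree, ← nsmul_one]
    exact Finset.sum_le_card_nsmul _ _ _ fun u _ => hle_one u w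
  have hcw : c ≤ G.degree w := by
    rw [hc, SimpleGraph.mul_adjMatrix_apply, SimpleGraph.degree, ← nsmul_one]
    exact Finset.sum_le_card_nsmul _ _ _ fun u _ => hle_one v u
  rw [interferenceKernel_apply, ← hc, Matrix.one_apply_ne hne, SimpleGraph.adjMatrix_apply,
    if_neg hvw, mul_zero, zero_add, zero_add, sub_neg, lt_div_iff₀ hcard]
  calc x ^ 2 * c * Fintype.card V = Fintype.card V * x * (x * c) := by ring
    _ ≤ 2 * (x * c) := by gcongr
    _ < (1 + x * c) * (1 + x * c) := by nlinarith [sq_nonneg (x * c)]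
    _ ≤ (1 + x * G.degree v) * (1 + x * G.degree w) := by gcongr

theorem distinctQ_eq_trace_sub_sum [Nonempty V] (t : ℕ) (x : ℝ) :
    distinctQ G t x
      = (interferenceKernel G x).trace - (t : ℝ)⁻¹ * ∑ v, ∑ w, interferenceKernel G x v w := by
  rw [trace_interferenceKernel, sum_interferenceKernel, distinctQ, distinctC11]
  ring

end Kernel

section RepeatedPairs

variable {V β : Type} [Fintype V] [DecidableEq β]

/-- The ordered pairs of distinct points on which `f` takes the same value. -/
def repeatedPairs (f : V → β) : Finset (V × V) := {p ∈ Finset.univ.offDiag | f p.1 = f p.2}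

theorem mem_repeatedPairs {f : V → β} {p : V × V} :
    p ∈ repeatedPairs f ↔ p.1 ≠ p.2 ∧ f p.1 = f p.2 := by
  simp [repeatedPairs]

theorem sum_ite_eq_trace_add_sum_repeatedPairs (f : V → β) (M : Matrix V V ℝ) :
    ∑ v, ∑ w, (if f v = f w then M v w else 0)
      = M.trace + ∑ p ∈ repeatedPairs f, M p.1 p.2 := by
  classical
  rw [repeatedPairs, Finset.sum_filter, ← Fintype.sum_prod_type', ← Finset.univ_product_univ,
    ← Finset.diag_union_offDiag, Finset.sum_union (Finset.disjoint_diag_offDiag _),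
    Finset.sum_diag]
  simp [Matrix.trace]

theorem sum_weighted_interferenceKernel [DecidableEq V] [Nonempty V] (G : SimpleGraph V)
    [DecidableRel G.Adj] (f : V → β) (t : ℕ) (x : ℝ) :
    ∑ v, ∑ w, ((if f v = f w then 1 else 0) - (t : ℝ)⁻¹) * interferenceKernel G x v w
      = distinctQ G t x + ∑ p ∈ repeatedPairs f, interferenceKernel G x p.1 p.2 := by
  simp only [sub_mul, ite_mul, one_mul, zero_mul, Finset.sum_sub_distrib, ← Finset.mul_sum,
    sum_ite_eq_trace_add_sum_repeatedPairs, distinctQ_eq_trace_sub_sum]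
  ring

end RepeatedPairs

/-! ### The graph of plots -/

section PathGraph

open SimpleGraph

instance (n : ℕ) : DecidableRel (pathGraph n).Adj :=
  fun _ _ => decidable_of_iff _ pathGraph_adj.symm

theorem card_filter_succ_eq {n : ℕ} (i : Fin n) :
    ({j | (j : ℕ) + 1 = i} : Finset (Fin n)).card = if (i : ℕ) = 0 then 0 else 1 := by
  split_ifs with hi
  · exact Finset.card_eq_zero.2 (Finset.filter_eq_empty_iff.2 fun j _ => by omega)
  · refine Finset.card_eq_one.2 ⟨⟨i - 1, by omega⟩, ?_⟩
    ext j
    simp only [Finset.mem_filter_univ, Finset.mem_singleton, Fin.ext_iff]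
    omega

theorem card_filter_eq_succ {n : ℕ} (i : Fin n) :
    ({j | (i : ℕ) + 1 = j} : Finset (Fin n)).card = if (i : ℕ) + 1 = n then 0 else 1 := by
  split_ifs with hi
  · exact Finset.card_eq_zero.2 (Finset.filter_eq_empty_iff.2 fun j _ => by omega)
  · refine Finset.card_eq_one.2 ⟨⟨i + 1, by omega⟩, ?_⟩
    ext j
    simp only [Finset.mem_filter_univ, Finset.mem_singleton, Fin.ext_iff]
    omega

theorem degree_pathGraph {n : ℕ} (i : Fin n) :
    (pathGraph n).degree i = (if (i : ℕ) = 0 then 0 else 1) + if (i : ℕ) + 1 = n then 0 else 1 := by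
  rw [degree, neighborFinset_eq_filter, ← card_filter_succ_eq, ← card_filter_eq_succ,
    ← Finset.card_union_of_disjoint]
  · congr 1
    ext j
    simp only [pathGraph_adj, Finset.mem_filter_univ, Finset.mem_union]
    tauto
  · exact Finset.disjoint_filter.2 fun j _ => by omega

theorem degree_pathGraph_add_two {n : ℕ} (i : Fin (n + 2)) :
    ((pathGraph (n + 2)).degree i : ℝ)
      = 2 - (if i = 0 then 1 else 0) - if i = Fin.last (n + 1) then 1 else 0 := by
  rw [degree_pathGraph]
  simp only [Fin.ext_iff, Fin.val_zero, Fin.val_last, Nat.reduceEqDiff]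
  split_ifs <;> norm_num

theorem sum_degree_pathGraph {n : ℕ} (hn : 2 ≤ n) :
    ∑ i, ((pathGraph n).degree i : ℝ) = 2 * n - 2 := by
  obtain ⟨n, rfl⟩ := Nat.exists_eq_add_of_le' hn
  simp only [degree_pathGraph_add_two, Finset.sum_sub_distrib, Finset.sum_ite_eq',
    Finset.mem_univ, if_true, Finset.sum_const, Finset.card_univ, Fintype.card_fin, nsmul_eq_mul]
  push_cast
  ring

theorem sum_degree_pathGraph_sq {n : ℕ} (hn : 2 ≤ n) :
    ∑ i, ((pathGraph n).degree i : ℝ) ^ 2 = 4 * n - 6 := by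
  obtain ⟨n, rfl⟩ := Nat.exists_eq_add_of_le' hn
  have hsq : ∀ i : Fin (n + 2), ((pathGraph (n + 2)).degree i : ℝ) ^ 2
      = 4 - 3 * (if i = 0 then 1 else 0) - 3 * if i = Fin.last (n + 1) then 1 else 0 := by
    intro i
    rw [degree_pathGraph_add_two]
    split_ifs with h0 hlast
    · exact absurd (h0.symm.trans hlast) (Fin.last_pos.ne)
    all_goals norm_num
  simp only [hsq, Finset.sum_sub_distrib, ← Finset.mul_sum, Finset.sum_ite_eq',
    Finset.mem_univ, if_true, Finset.sum_const, Finset.card_univ, Fintype.card_fin, nsmul_eq_mul]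
  push_cast
  ring

end PathGraph

section PlotGraph

variable {a b t : ℕ}

/-- The grid graph of the plots of a block; its edges are the pairs of plots that interfere. -/
def plotGraph (a b : ℕ) : SimpleGraph (Plot a b) :=
  SimpleGraph.pathGraph b □ SimpleGraph.pathGraph a

instance : DecidableRel (plotGraph a b).Adj :=
  fun _ _ => decidable_of_iff _ SimpleGraph.boxProd_adj.symm

theorem plotGraph_adj {u v : Plot a b} : (plotGraph a b).Adj u v ↔ Adjacent u v := by
  simp only [plotGraph, SimpleGraph.boxProd_adj, SimpleGraph.pathGraph_adj, Adjacent]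
  tauto

theorem degree_plotGraph (j : Fin b) (i : Fin a) : (plotGraph a b).degree (j, i)
    = (SimpleGraph.pathGraph b).degree j + (SimpleGraph.pathGraph a).degree i := by
  rw [← SimpleGraph.degree_boxProd (G := SimpleGraph.pathGraph b)
    (H := SimpleGraph.pathGraph a) (j, i)]
  congr!

theorem sum_degree_plotGraph (ha : 2 ≤ a) (hb : 2 ≤ b) :
    ∑ v, ((plotGraph a b).degree v : ℝ) = 4 * (a * b) - 2 * a - 2 * b := by
  simp only [degree_plotGraph, Fintype.sum_prod_type, Nat.cast_add,
    Finset.sum_add_distrib, Finset.sum_const, ← Finset.mul_sum, sum_degree_pathGraph ha,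
    sum_degree_pathGraph hb, Finset.card_univ, Fintype.card_fin, nsmul_eq_mul]
  ring

theorem sum_degree_plotGraph_sq (ha : 2 ≤ a) (hb : 2 ≤ b) :
    ∑ v, ((plotGraph a b).degree v : ℝ) ^ 2 = 16 * (a * b) - 14 * a - 14 * b + 8 := by
  simp only [degree_plotGraph, Fintype.sum_prod_type, Nat.cast_add, add_sq,
    Finset.sum_add_distrib, ← Finset.mul_sum, ← Finset.sum_mul, Finset.sum_const,
    sum_degree_pathGraph ha, sum_degree_pathGraph hb,
    sum_degree_pathGraph_sq ha, sum_degree_pathGraph_sq hb, Finset.card_univ, Fintype.card_fin,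
    nsmul_eq_mul]
  ring

theorem distinctC11_plotGraph (ha : 2 ≤ a) (hb : 2 ≤ b) (t : ℕ) :
    distinctC11 (plotGraph a b) t
      = eta a b t - (16 * (a * b) - 14 * a - 14 * b + 8) / (a * b) := by
  have ha0 : (a : ℝ) ≠ 0 := by positivity
  have hb0 : (b : ℝ) ≠ 0 := by positivity
  rw [distinctC11, sum_degree_plotGraph ha hb, sum_degree_plotGraph_sq ha hb, eta,
    Fintype.card_prod, Fintype.card_fin, Fintype.card_fin, Nat.cast_mul, mul_comm (b : ℝ)]
  field_simp
  ring

theorem Adjacent.not_adjacent_of_adjacent {u v w : Plot a b} (huv : Adjacent u v)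
    (hvw : Adjacent v w) : ¬ Adjacent u w := by
  have parity : ∀ {u v : Plot a b}, Adjacent u v →
      ((u.1 : ℕ) + u.2) % 2 ≠ ((v.1 : ℕ) + v.2) % 2 := by
    rintro u v (⟨h1, h2⟩ | ⟨h1, h2⟩) <;> rw [Fin.ext_iff] at h1 <;> omega
  intro huw
  have := parity huv
  have := parity hvw
  have := parity huw
  omega

theorem two_le_degree_plotGraph (ha : 2 ≤ a) (hb : 2 ≤ b) (u : Plot a b) :
    2 ≤ (plotGraph a b).degree u := by
  obtain ⟨j, i⟩ := u
  rw [degree_plotGraph, degree_pathGraph, degree_pathGraph]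
  grind

theorem isCorner_iff_degree_eq_two (ha : 2 ≤ a) (hb : 2 ≤ b) {u : Plot a b} :
    IsCorner u ↔ (plotGraph a b).degree u = 2 := by
  obtain ⟨j, i⟩ := u
  rw [degree_plotGraph, degree_pathGraph, degree_pathGraph, IsCorner]
  grind

theorem three_le_degree_plotGraph (ha : 2 ≤ a) (hb : 2 ≤ b) {u : Plot a b} (hu : ¬ IsCorner u) :
    3 ≤ (plotGraph a b).degree u :=
  (two_le_degree_plotGraph ha hb u).lt_of_ne' (mt (isCorner_iff_degree_eq_two ha hb).2 hu)

theorem Adjacent.degree_eq_three (ha : 3 ≤ a) (hb : 3 ≤ b) {u v : Plot a b} (huv : Adjacent u v)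
    (hu : IsCorner u) : (plotGraph a b).degree v = 3 := by
  obtain ⟨j, i⟩ := v
  rw [degree_plotGraph, degree_pathGraph, degree_pathGraph]
  unfold Adjacent IsCorner at *
  grind

end PlotGraph

/-! ### The functions `q_s` for uncorrelated errors -/

section Uncorrelated

variable {a b t : ℕ}

theorem sideMat_eq_adjMatrix_mul (s : BlockArray a b t) :
    sideMat s = (plotGraph a b).adjMatrix ℝ * directMat s := by
  rw [sideMat, ← Matrix.add_mul, ← Matrix.add_mul, ← Matrix.add_mul]
  congr 1
  ext ⟨j, i⟩ ⟨l, k⟩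
  simp only [Matrix.add_apply, Matrix.kroneckerMap_apply, Matrix.transpose_apply, shiftK,
    Matrix.of_apply, Matrix.one_apply, SimpleGraph.adjMatrix_apply, plotGraph_adj, Adjacent,
    Fin.ext_iff]
  grind

theorem directMat_mul_centering_mul_transpose_apply (s : BlockArray a b t) (v w : Plot a b) :
    (directMat s * centering t * (directMat s)ᵀ) v w
      = (if s.treat v = s.treat w then 1 else 0) - (t : ℝ)⁻¹ := by
  rw [centering_eq_meanCentering, mul_meanCentering_mul_transpose_apply]
  simp [directMat, Matrix.mul_apply, Matrix.mulVec, dotProduct]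

theorem q_one_eq_trace (s : BlockArray a b t) (x : ℝ) :
    q 1 s x = (centering t *
      ((directMat s)ᵀ * interferenceKernel (plotGraph a b) x * directMat s)).trace := by
  rw [q, c00, c01, c11, C00, C01, C11, sideMat_eq_adjMatrix_mul, Btilde_one, interferenceKernel]
  set A := (plotGraph a b).adjMatrix ℝ
  set B := meanCentering (Plot a b)
  set C := centering t with hC
  set D := directMat s
  have hAt : Aᵀ = A := SimpleGraph.transpose_adjMatrix _
  have hCt : Cᵀ = C := by rw [hC, centering_eq_meanCentering, transpose_meanCentering]
  have hcross : (C * (Dᵀ * (A * (B * D)))).trace = (C * (Dᵀ * (B * (A * D)))).trace := by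
    rw [← Matrix.trace_transpose]
    simp only [Matrix.transpose_mul, Matrix.transpose_transpose, hAt, hCt, B,
      transpose_meanCentering]
    rw [Matrix.trace_mul_comm]
    simp only [Matrix.mul_assoc]
  simp only [Matrix.add_mul, Matrix.mul_add, Matrix.one_mul, Matrix.mul_one, Matrix.smul_mul,
    Matrix.mul_smul, Matrix.transpose_mul, hAt, Matrix.mul_assoc, Matrix.trace_add,
    Matrix.trace_smul, smul_eq_mul, hcross]
  ring

theorem q_one_nonneg (s : BlockArray a b t) (x : ℝ) : 0 ≤ q 1 s x := by
  have hpsd : ((directMat s)ᵀ * interferenceKernel (plotGraph a b) x * directMat s).PosSemidef := by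
    have hY := (posSemidef_meanCentering (Plot a b)).conjTranspose_mul_mul_same
      ((1 + x • (plotGraph a b).adjMatrix ℝ) * directMat s)
    rw [Matrix.conjTranspose_eq_transpose_of_trivial, Matrix.transpose_mul,
      (isSymm_one_add_smul_adjMatrix _ x).eq] at hY
    simpa only [interferenceKernel, Matrix.mul_assoc] using hY
  have hconj := (hpsd.conjTranspose_mul_mul_same (centering t)).trace_nonneg
  rwa [Matrix.trace_mul_comm, Matrix.conjTranspose_eq_transpose_of_trivial, ← Matrix.mul_assoc,
    centering_eq_meanCentering, transpose_meanCentering, meanCentering_mul_self,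
    ← centering_eq_meanCentering, ← q_one_eq_trace] at hconj

theorem q_one_eq_sum_weighted_interferenceKernel (s : BlockArray a b t) (x : ℝ) :
    q 1 s x = ∑ v, ∑ w, ((if s.treat v = s.treat w then 1 else 0) - (t : ℝ)⁻¹)
      * interferenceKernel (plotGraph a b) x v w := by
  rw [q_one_eq_trace, ← Matrix.mul_assoc, Matrix.trace_mul_comm, ← Matrix.mul_assoc,
    ← Matrix.mul_assoc, Matrix.trace_mul_comm]
  simp only [Matrix.trace, Matrix.diag_apply, Matrix.mul_apply (M := interferenceKernel _ _),
    directMat_mul_centering_mul_transpose_apply]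
  refine Finset.sum_congr rfl fun v _ => Finset.sum_congr rfl fun w _ => ?_
  rw [mul_comm, if_congr (eq_comm (a := s.treat w)) rfl rfl]

theorem q_one_eq_distinctQ_add [Nonempty (Plot a b)] (s : BlockArray a b t) (x : ℝ) :
    q 1 s x = distinctQ (plotGraph a b) t x
      + ∑ p ∈ repeatedPairs s.treat, interferenceKernel (plotGraph a b) x p.1 p.2 := by
  rw [q_one_eq_sum_weighted_interferenceKernel, sum_weighted_interferenceKernel]

theorem card_plot : (Fintype.card (Plot a b) : ℝ) = a * b := by
  simp [mul_comm]

theorem interferenceKernel_plotGraph_of_adjacent {u v : Plot a b} (huv : Adjacent u v) (x : ℝ) :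
    interferenceKernel (plotGraph a b) x u v = 2 * x - (1 + x * (plotGraph a b).degree u)
      * (1 + x * (plotGraph a b).degree v) / Fintype.card (Plot a b) :=
  interferenceKernel_apply_of_adj (plotGraph_adj.2 huv) (fun _ huw hwv =>
    (plotGraph_adj.1 huw).not_adjacent_of_adjacent (plotGraph_adj.1 hwv) huv) x

theorem c01_eq_and_c11_eq_of_q_eq {Sig : Matrix (Plot a b) (Plot a b) ℝ} {s : BlockArray a b t}
    {α β γ : ℝ} (h : ∀ x, q Sig s x = α + 2 * β * x + γ * x ^ 2) :
    c01 Sig s = β ∧ c11 Sig s = γ := by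
  have h₀ := h 0
  have h₁ := h 1
  have h₂ := h (-1)
  simp only [q] at h₀ h₁ h₂
  constructor <;> linarith

end Uncorrelated

/-! ### Significant treatments -/

section Repetitions

variable {a b t : ℕ} {s : BlockArray a b t} {m : Fin t} {R : Plot a b → Plot a b → Prop}

theorem Adjacent.symm {u v : Plot a b} (h : Adjacent u v) : Adjacent v u :=
  plotGraph_adj.1 (plotGraph_adj.2 h).symm

theorem Adjacent.ne {u v : Plot a b} (h : Adjacent u v) : u ≠ v := (plotGraph_adj.2 h).ne

/-- Two adjacent plots, at least one of which is a corner: the plots on which a significant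
treatment appears. -/
def SignificantPair (u v : Plot a b) : Prop := Adjacent u v ∧ (IsCorner u ∨ IsCorner v)

/-- Two adjacent corners: the plots on which a strictly significant treatment appears. -/
def StrictlySignificantPair (u v : Plot a b) : Prop := Adjacent u v ∧ IsCorner u ∧ IsCorner v

instance : Std.Symm (SignificantPair (a := a) (b := b)) := ⟨fun _ _ h => ⟨h.1.symm, h.2.symm⟩⟩

instance : Std.Symm (StrictlySignificantPair (a := a) (b := b)) :=
  ⟨fun _ _ h => ⟨h.1.symm, h.2.symm⟩⟩

/-- Any two plots with the same treatment are related by `R`. For the two relations above this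
describes the unions of the classes `𝒬_i` and `𝒬*_j` in the theorem. -/
def RepeatsIn (R : Plot a b → Plot a b → Prop) (s : BlockArray a b t) : Prop :=
  ∀ v w, v ≠ w → s.treat v = s.treat w → R v w

theorem repeatsIn_iff [Std.Symm R] (hadj : ∀ u v, R u v → Adjacent u v) :
    RepeatsIn R s ↔
      ∀ m, replications s m ≤ 1 ∨ ∃ u v, R u v ∧ {w | s.treat w = m} = {u, v} := by
  constructor
  · intro hs m
    refine or_iff_not_imp_left.2 fun hm => ?_
    obtain ⟨u, hu, v, hv, huv⟩ := (Set.one_lt_ncard).1 (not_le.1 hm)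
    have hRuv := hs u v huv (hu.trans hv.symm)
    refine ⟨u, v, hRuv, Set.Subset.antisymm (fun w hw => ?_) (Set.pair_subset hu hv)⟩
    by_contra! hne
    rw [Set.mem_insert_iff, Set.mem_singleton_iff, not_or] at hne
    have hvw := hs v w (Ne.symm hne.2) (hv.trans hw.symm)
    have huw := hs u w (Ne.symm hne.1) (hu.trans hw.symm)
    exact (hadj u v hRuv).not_adjacent_of_adjacent (hadj v w hvw) (hadj u w huw)
  · intro hs v w hvw htreat
    rcases hs (s.treat v) with hone | ⟨x, y, hxy, hfiber⟩
    · exact absurd ((Set.ncard_le_one).1 hone v rfl w htreat.symm) hvw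
    · have hv : v ∈ ({x, y} : Set (Plot a b)) := hfiber ▸ rfl
      have hw : w ∈ ({x, y} : Set (Plot a b)) := hfiber ▸ htreat.symm
      rcases hv with rfl | rfl <;> rcases hw with rfl | rfl
      exacts [absurd rfl hvw, hxy, symm_of R hxy, absurd rfl hvw]

theorem isSignificant_iff :
    IsSignificant s m ↔ ∃ u v, SignificantPair u v ∧ {w | s.treat w = m} = {u, v} := by
  constructor
  · rintro ⟨htwo, ⟨u, v, hu, hv, huv⟩, c, hc, hcorner⟩
    have hsub : {u, v} ⊆ {w | s.treat w = m} := Set.pair_subset hu hv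
    have hfiber : {w | s.treat w = m} = {u, v} :=
      (Set.eq_of_subset_of_ncard_le hsub (htwo.trans (Set.ncard_pair huv.ne).symm).le).symm
    have hmem : c ∈ ({u, v} : Set (Plot a b)) := hfiber ▸ hc
    refine ⟨u, v, ⟨huv, ?_⟩, hfiber⟩
    rcases hmem with rfl | rfl
    exacts [Or.inl hcorner, Or.inr hcorner]
  · rintro ⟨u, v, ⟨huv, hcorner⟩, hfiber⟩
    have hu : s.treat u = m := (Set.ext_iff.1 hfiber u).2 (Or.inl rfl)
    have hv : s.treat v = m := (Set.ext_iff.1 hfiber v).2 (Or.inr rfl)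
    refine ⟨by rw [replications, hfiber, Set.ncard_pair huv.ne], ⟨u, v, hu, hv, huv⟩, ?_⟩
    exact hcorner.elim (fun h => ⟨u, hu, h⟩) fun h => ⟨v, hv, h⟩

theorem isStrictlySignificant_iff :
    IsStrictlySignificant s m ↔
      ∃ u v, StrictlySignificantPair u v ∧ {w | s.treat w = m} = {u, v} := by
  rw [IsStrictlySignificant, isSignificant_iff]
  constructor
  · rintro ⟨⟨u, v, ⟨huv, -⟩, hfiber⟩, hcorner⟩
    exact ⟨u, v, ⟨huv, hcorner u ((Set.ext_iff.1 hfiber u).2 (Or.inl rfl)),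
      hcorner v ((Set.ext_iff.1 hfiber v).2 (Or.inr rfl))⟩, hfiber⟩
  · rintro ⟨u, v, ⟨huv, hu, hv⟩, hfiber⟩
    refine ⟨⟨u, v, ⟨huv, Or.inl hu⟩, hfiber⟩, fun w hw => ?_⟩
    have hmem : w ∈ ({u, v} : Set (Plot a b)) := hfiber ▸ hw
    rcases hmem with rfl | rfl
    exacts [hu, hv]

theorem repeatsIn_significantPair_iff :
    RepeatsIn SignificantPair s ↔ ∀ m, replications s m ≤ 1 ∨ IsSignificant s m := by
  simp only [repeatsIn_iff (R := SignificantPair) fun _ _ h => h.1, isSignificant_iff]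

theorem repeatsIn_strictlySignificantPair_iff :
    RepeatsIn StrictlySignificantPair s ↔
      ∀ m, replications s m ≤ 1 ∨ IsStrictlySignificant s m := by
  simp only [repeatsIn_iff (R := StrictlySignificantPair) fun _ _ h => h.1,
    isStrictlySignificant_iff]

end Repetitions

section Classes

variable {a b t : ℕ} {s : BlockArray a b t}

theorem sum_replications (s : BlockArray a b t) : ∑ m, replications s m = a * b := by
  simp only [replications, Set.ncard_eq_toFinset_card', Set.toFinset_ofPred]
  rw [← Finset.card_eq_sum_card_fiberwise fun _ _ => Finset.mem_coe.2 (Finset.mem_univ _),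
    Finset.card_univ, Fintype.card_prod, Fintype.card_fin, Fintype.card_fin, mul_comm]

theorem ncard_add_two_mul_ncard_eq_sum_iff {ι : Type} [Fintype ι] {f : ι → ℕ} {S : Set ι}
    (hS : ∀ m ∈ S, f m = 2) :
    {m | f m = 1}.ncard + 2 * S.ncard = ∑ m, f m ↔ ∀ m, f m ≤ 1 ∨ m ∈ S := by
  classical
  have hsum : {m | f m = 1}.ncard + 2 * S.ncard
      = ∑ m, ((if f m = 1 then 1 else 0) + if m ∈ S then 2 else 0) := by
    rw [Set.ncard_eq_toFinset_card', Set.ncard_eq_toFinset_card', Finset.sum_add_distrib,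
      ← Finset.sum_filter, ← Finset.sum_filter, Finset.sum_const, Finset.sum_const, smul_eq_mul,
      smul_eq_mul, mul_one, mul_comm 2, Set.toFinset_ofPred, ← Set.filter_mem_univ_eq_toFinset]
  rw [hsum, Finset.sum_eq_sum_iff_of_le]
  · refine (forall_congr' fun m => ?_)
    have := hS m
    by_cases hm : m ∈ S <;> grind
  · intro m _
    have := hS m
    split_ifs <;> grind

theorem mem_QSet_iff {i : ℕ} :
    s ∈ QSet a b t i ↔
      {m | IsSignificant s m}.ncard = i ∧ RepeatsIn SignificantPair s := by
  rw [repeatsIn_significantPair_iff, QSet, Set.mem_ofPred_eq, and_congr_right_iff]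
  rintro rfl
  rw [← sum_replications s]
  exact ncard_add_two_mul_ncard_eq_sum_iff fun m hm => hm.1

theorem mem_QStarSet_iff {j : ℕ} :
    s ∈ QStarSet a b t j ↔
      {m | IsSignificant s m}.ncard = j ∧ RepeatsIn StrictlySignificantPair s := by
  rw [QStarSet, Set.mem_ofPred_eq, mem_QSet_iff, and_assoc, repeatsIn_significantPair_iff,
    repeatsIn_strictlySignificantPair_iff, and_congr_right_iff]
  refine fun _ => ⟨fun h m => (h.1 m).imp_right (h.2 m),
    fun h => ⟨fun m => (h m).imp_right And.left,
      fun m hm => (h m).resolve_left ?_⟩⟩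
  rw [hm.1]
  norm_num

theorem card_corners_le [DecidablePred (IsCorner (a := a) (b := b))] :
    ({u | IsCorner u} : Finset (Plot a b)).card ≤ 4 := by
  refine (Finset.card_le_card_of_injOn (t := (Finset.univ : Finset (Bool × Bool)))
    (fun u => (decide ((u.1 : ℕ) = 0), decide ((u.2 : ℕ) = 0))) (fun _ _ => Finset.mem_univ _)
    ?_).trans_eq rfl
  rintro ⟨j, i⟩ hu ⟨l, k⟩ hv h
  replace hu : IsCorner (j, i) := by simpa using hu
  replace hv : IsCorner (l, k) := by simpa using hv
  simp only [IsCorner] at hu hv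
  simp only [Prod.mk.injEq, decide_eq_decide] at h
  simp only [Prod.mk.injEq, Fin.ext_iff]
  omega

theorem ncard_mul_le_four {S : Set (Fin t)} {n : ℕ}
    (hS : ∀ m ∈ S, n ≤ {u | IsCorner u ∧ s.treat u = m}.ncard) : S.ncard * n ≤ 4 := by
  classical
  by_contra! h
  rw [Set.ncard_eq_toFinset_card'] at h
  obtain ⟨m, hm, hlt⟩ := Finset.exists_card_fiber_lt_of_card_lt_mul (f := s.treat)
    ((card_corners_le (a := a) (b := b)).trans_lt h)
  rw [Finset.filter_filter, ← Set.toFinset_ofPred, ← Set.ncard_eq_toFinset_card'] at hlt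
  exact hlt.not_ge (hS m (Set.mem_toFinset.1 hm))

theorem ncard_isSignificant_le_four : {m | IsSignificant s m}.ncard ≤ 4 := by
  rw [← mul_one (Set.ncard _)]
  refine ncard_mul_le_four (s := s) fun m hm => ?_
  obtain ⟨u, hu, hcorner⟩ := hm.2.2
  exact (Set.ncard_pos).2 ⟨u, hcorner, hu⟩

theorem ncard_isSignificant_le_two (hs : RepeatsIn StrictlySignificantPair s) :
    {m | IsSignificant s m}.ncard ≤ 2 := by
  have hfiber : ∀ m ∈ {m | IsSignificant s m}, 2 ≤ {u | IsCorner u ∧ s.treat u = m}.ncard := by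
    rintro m ⟨-, ⟨u, v, hu, hv, huv⟩, -⟩
    obtain ⟨-, hcu, hcv⟩ := hs u v huv.ne (hu.trans hv.symm)
    rw [← Set.ncard_pair huv.ne]
    exact Set.ncard_le_ncard (Set.pair_subset ⟨hcu, hu⟩ ⟨hcv, hv⟩)
  have := ncard_mul_le_four hfiber
  omega

theorem iUnion_QSet_eq (a b t : ℕ) :
    ⋃ i ∈ Finset.range 5, QSet a b t i = {s | RepeatsIn SignificantPair s} := by
  ext s
  simp only [Set.mem_iUnion, mem_QSet_iff, Finset.mem_range, exists_prop, Set.mem_ofPred_eq]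
  exact ⟨fun ⟨_, _, _, hs⟩ => hs,
    fun hs => ⟨_, Nat.lt_succ_of_le ncard_isSignificant_le_four, rfl, hs⟩⟩

theorem QSet_zero_eq_QStarSet_zero (a b t : ℕ) : QSet a b t 0 = QStarSet a b t 0 := by
  refine Set.Subset.antisymm (fun s hs => ⟨hs, fun m hm => ?_⟩) fun s hs => hs.1
  exact absurd hm (Set.eq_empty_iff_forall_notMem.1 ((Set.ncard_eq_zero).1 hs.1) m)

theorem QSet_union_QStarSet_eq (a b t : ℕ) :
    QSet a b t 0 ∪ QStarSet a b t 1 ∪ QStarSet a b t 2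
      = {s | RepeatsIn StrictlySignificantPair s} := by
  rw [QSet_zero_eq_QStarSet_zero]
  ext s
  simp only [Set.mem_union, mem_QStarSet_iff, Set.mem_ofPred_eq, ← or_and_right,
    and_iff_right_iff_imp]
  intro hs
  have := ncard_isSignificant_le_two hs
  omega

end Classes

/-! ### Arrays without repetitions and arrays with two pairs -/

section Arrays

variable {a b t : ℕ}

/-- The array whose treatments are pairwise distinct, given by an injection `e`. -/
def distinctArray (e : Plot a b ↪ Fin t) : BlockArray a b t := fun i j => e (j, i)

/-- The array obtained from `distinctArray e` by giving the second plot of the first and of the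
last column the treatment of the corner above it. -/
def pairedArray (e : Plot a b ↪ Fin t) : BlockArray a b t := fun i j =>
  if (i : ℕ) = 1 ∧ ((j : ℕ) = 0 ∨ (j : ℕ) + 1 = b) then e (j, ⟨0, i.pos⟩) else e (j, i)

theorem repeatsIn_distinctArray (e : Plot a b ↪ Fin t) (R : Plot a b → Plot a b → Prop) :
    RepeatsIn R (distinctArray e) :=
  fun _ _ huv h => absurd (e.injective h) huv

theorem q_one_distinctArray [Nonempty (Plot a b)] (e : Plot a b ↪ Fin t) (x : ℝ) :
    q 1 (distinctArray e) x = distinctQ (plotGraph a b) t x := by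
  rw [q_one_eq_distinctQ_add, add_eq_left]
  refine Finset.sum_eq_zero fun p hp => ?_
  obtain ⟨hne, h⟩ := mem_repeatedPairs.1 hp
  exact absurd (e.injective h) hne

theorem mem_repeatedPairs_pairedArray {e : Plot a b ↪ Fin t} {u v : Plot a b} :
    (u, v) ∈ repeatedPairs (pairedArray e).treat ↔
      u.1 = v.1 ∧ ((u.1 : ℕ) = 0 ∨ (u.1 : ℕ) + 1 = b) ∧
        ((u.2 : ℕ) = 0 ∧ (v.2 : ℕ) = 1 ∨ (u.2 : ℕ) = 1 ∧ (v.2 : ℕ) = 0) := by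
  obtain ⟨j, i⟩ := u
  obtain ⟨l, k⟩ := v
  simp only [mem_repeatedPairs, BlockArray.treat, pairedArray]
  split_ifs <;> simp only [e.injective.eq_iff, ne_eq, Prod.mk.injEq, Fin.ext_iff] <;> omega

theorem repeatsIn_pairedArray (e : Plot a b ↪ Fin t) :
    RepeatsIn SignificantPair (pairedArray e) := by
  intro u v huv h
  have hmem := mem_repeatedPairs_pairedArray.1 (mem_repeatedPairs.2 ⟨huv, h⟩)
  unfold SignificantPair Adjacent IsCorner
  simp only [Fin.ext_iff] at hmem ⊢
  omega

theorem repeatsIn_pairedArray_of_two_rows (e : Plot 2 b ↪ Fin t) :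
    RepeatsIn StrictlySignificantPair (pairedArray e) := by
  intro u v huv h
  have hmem := mem_repeatedPairs_pairedArray.1 (mem_repeatedPairs.2 ⟨huv, h⟩)
  unfold StrictlySignificantPair Adjacent IsCorner
  simp only [Fin.ext_iff] at hmem ⊢
  omega

theorem card_repeatedPairs_pairedArray (ha : 2 ≤ a) (hb : 2 ≤ b) (e : Plot a b ↪ Fin t) :
    (repeatedPairs (pairedArray e).treat).card = 4 := by
  have himage : repeatedPairs (pairedArray e).treat
      = (Finset.univ : Finset (Bool × Bool)).image fun c =>
        let j : Fin b := if c.1 then ⟨0, by omega⟩ else ⟨b - 1, by omega⟩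
        if c.2 then ((j, ⟨0, by omega⟩), (j, ⟨1, ha⟩))
        else ((j, ⟨1, ha⟩), (j, ⟨0, by omega⟩)) := by
    ext ⟨⟨j, i⟩, ⟨l, k⟩⟩
    rw [mem_repeatedPairs_pairedArray]
    simp only [Finset.mem_image, Finset.mem_univ, true_and, Prod.exists, Bool.exists_bool,
      Bool.false_eq_true, if_true, if_false, Prod.mk.injEq, Fin.ext_iff]
    omega
  rw [himage, Finset.card_image_of_injective]
  · rfl
  · rintro ⟨c, d⟩ ⟨c', d'⟩ h
    grind

theorem c01_one_distinctArray [Nonempty (Plot a b)] (e : Plot a b ↪ Fin t) :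
    c01 1 (distinctArray e) = -(∑ v, ((plotGraph a b).degree v : ℝ)) / Fintype.card (Plot a b) :=
  (c01_eq_and_c11_eq_of_q_eq fun x => q_one_distinctArray e x).1

theorem c11_one_distinctArray [Nonempty (Plot a b)] (e : Plot a b ↪ Fin t) :
    c11 1 (distinctArray e) = distinctC11 (plotGraph a b) t :=
  (c01_eq_and_c11_eq_of_q_eq fun x => q_one_distinctArray e x).2

theorem c01_one_eq_add_sum [Nonempty (Plot a b)] {s : BlockArray a b t}
    (hs : RepeatsIn Adjacent s) :
    c01 1 s = -(∑ v, ((plotGraph a b).degree v : ℝ)) / Fintype.card (Plot a b)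
      + ∑ p ∈ repeatedPairs s.treat,
        (1 - ((plotGraph a b).degree p.1 + (plotGraph a b).degree p.2 : ℝ)
          / (2 * Fintype.card (Plot a b))) := by
  set G := plotGraph a b
  set N := (Fintype.card (Plot a b) : ℝ)
  have hN0 : N ≠ 0 := Nat.cast_ne_zero.2 Fintype.card_ne_zero
  refine (c01_eq_and_c11_eq_of_q_eq (α := N - 1 - (repeatedPairs s.treat).card * N⁻¹)
    (γ := distinctC11 G t
      - ∑ p ∈ repeatedPairs s.treat, (G.degree p.1 : ℝ) * G.degree p.2 / N) fun x => ?_).1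
  have hkernel : ∀ p ∈ repeatedPairs s.treat, interferenceKernel G x p.1 p.2
      = -N⁻¹ + 2 * (1 - ((G.degree p.1 : ℝ) + G.degree p.2) / (2 * N)) * x
        - (G.degree p.1 : ℝ) * G.degree p.2 / N * x ^ 2 := by
    intro p hp
    obtain ⟨hne, hp⟩ := mem_repeatedPairs.1 hp
    rw [interferenceKernel_plotGraph_of_adjacent (hs _ _ hne hp)]
    field_simp
    ring
  rw [q_one_eq_distinctQ_add, distinctQ, Finset.sum_congr rfl hkernel, Finset.sum_sub_distrib,
    Finset.sum_add_distrib, Finset.sum_const, nsmul_eq_mul, ← Finset.sum_mul, ← Finset.mul_sum,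
    ← Finset.sum_mul]
  ring

theorem c01_one_pairedArray_pos (ha : 2 ≤ a) (hb : 2 ≤ b) (e : Plot a b ↪ Fin t)
    (hdeg : RepeatsIn (fun u v => (plotGraph a b).degree u + (plotGraph a b).degree v < a + b)
      (pairedArray e)) :
    0 < c01 1 (pairedArray e) := by
  have : (0 : ℝ) < a * b := by positivity
  have : Nonempty (Plot a b) := ⟨⟨0, by omega⟩, ⟨0, by omega⟩⟩
  have hterm : ∀ p ∈ repeatedPairs (pairedArray e).treat, 1 - ((a : ℝ) + b) / (2 * (a * b))
      < 1 - (((plotGraph a b).degree p.1 : ℝ) + (plotGraph a b).degree p.2) / (2 * (a * b)) := by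
    intro p hp
    obtain ⟨hne, hp⟩ := mem_repeatedPairs.1 hp
    have hlt : ((plotGraph a b).degree p.1 + (plotGraph a b).degree p.2 : ℝ) < a + b := by
      exact_mod_cast hdeg _ _ hne hp
    gcongr
  have hcard := card_repeatedPairs_pairedArray ha hb e
  have hsum := Finset.sum_lt_sum_of_nonempty (Finset.card_pos.1 (by omega)) hterm
  rw [Finset.sum_const, hcard, nsmul_eq_mul] at hsum
  rw [c01_one_eq_add_sum fun u v huv h => (repeatsIn_pairedArray e u v huv h).1, card_plot,
    sum_degree_plotGraph ha hb]
  refine lt_of_eq_of_lt ?_ (add_lt_add_right hsum _)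
  field_simp
  push_cast
  ring

end Arrays

/-! ### Optimality at a critical parameter -/

section Critical

variable {a b t : ℕ} {x : ℝ} {R : Plot a b → Plot a b → Prop}

/-- At a parameter `x` critical for `R`, repeating a treatment costs nothing at the pairs of plots
in `R` and strictly decreases `q_s(x)` at all others. -/
structure IsCritical (R : Plot a b → Plot a b → Prop) (x : ℝ) : Prop where
  eq_zero : ∀ u v, R u v → interferenceKernel (plotGraph a b) x u v = 0
  neg : ∀ u v, u ≠ v → ¬ R u v → interferenceKernel (plotGraph a b) x u v < 0

theorem IsCritical.nonpos (h : IsCritical R x) {s : BlockArray a b t} {p : Plot a b × Plot a b}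
    (hp : p ∈ repeatedPairs s.treat) : interferenceKernel (plotGraph a b) x p.1 p.2 ≤ 0 := by
  by_cases hR : R p.1 p.2
  · exact (h.eq_zero _ _ hR).le
  · exact (h.neg _ _ (mem_repeatedPairs.1 hp).1 hR).le

theorem IsCritical.q_one_le [Nonempty (Plot a b)] (h : IsCritical R x) (s : BlockArray a b t) :
    q 1 s x ≤ distinctQ (plotGraph a b) t x := by
  rw [q_one_eq_distinctQ_add, add_le_iff_nonpos_right]
  exact Finset.sum_nonpos fun _ => h.nonpos

theorem IsCritical.q_one_eq_iff [Nonempty (Plot a b)] (h : IsCritical R x)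
    {s : BlockArray a b t} : q 1 s x = distinctQ (plotGraph a b) t x ↔ RepeatsIn R s := by
  rw [q_one_eq_distinctQ_add, add_eq_left, Finset.sum_eq_zero_iff_of_nonpos fun _ => h.nonpos]
  refine ⟨fun hzero u v huv hs => ?_, fun hs p hp => ?_⟩
  · by_contra hR
    exact (h.neg u v huv hR).ne (hzero (u, v) (mem_repeatedPairs.2 ⟨huv, hs⟩))
  · obtain ⟨hne, hp⟩ := mem_repeatedPairs.1 hp
    exact h.eq_zero _ _ (hs _ _ hne hp)

theorem IsCritical.isOptimalTriple [Nonempty (Plot a b)] (h : IsCritical R x)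
    {s₀ s₁ : BlockArray a b t} (hs₀ : RepeatsIn R s₀) (hs₁ : RepeatsIn R s₁)
    (hc₀ : c01 1 s₀ ≠ 0) (hc₁ : c01 1 s₁ ≠ 0)
    (hslope₀ : c01 1 s₀ + c11 1 s₀ * x ≤ 0) (hslope₁ : 0 ≤ c01 1 s₁ + c11 1 s₁ * x) :
    IsOptimalTriple (1 : Matrix (Plot a b) (Plot a b) ℝ) x (distinctQ (plotGraph a b) t x)
      {s : BlockArray a b t | RepeatsIn R s} := by
  simpa only [h.q_one_eq_iff] using isOptimalTriple_of_slopes q_one_nonneg h.q_one_le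
    (h.q_one_eq_iff.2 hs₀) (h.q_one_eq_iff.2 hs₁) hc₀ hc₁ hslope₀ hslope₁

theorem c01_one_distinctArray_neg (ha : 2 ≤ a) (hb : 2 ≤ b) (e : Plot a b ↪ Fin t) :
    c01 1 (distinctArray e) < 0 := by
  have : Nonempty (Plot a b) := ⟨⟨0, by omega⟩, ⟨0, by omega⟩⟩
  rw [c01_one_distinctArray, neg_div, neg_lt_zero]
  refine div_pos (Finset.sum_pos (fun u _ => ?_) Finset.univ_nonempty) ?_
  · exact_mod_cast two_pos.trans_le (two_le_degree_plotGraph ha hb u)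
  · exact_mod_cast Fintype.card_pos

theorem slope_distinctArray_nonpos [Nonempty (Plot a b)] (hx : 0 ≤ x) (hpx : a * b * x ≤ 1)
    (e : Plot a b ↪ Fin t) :
    c01 1 (distinctArray e) + c11 1 (distinctArray e) * x ≤ 0 := by
  rw [c01_one_distinctArray, c11_one_distinctArray]
  rw [← card_plot] at hpx
  set D := ∑ v, ((plotGraph a b).degree v : ℝ)
  set N := (Fintype.card (Plot a b) : ℝ)
  have hN0 : N ≠ 0 := Nat.cast_ne_zero.2 Fintype.card_ne_zero
  calc -D / N + distinctC11 (plotGraph a b) t * x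
      ≤ -D / N + D * x := by
        gcongr
        exact distinctC11_le _ _
    _ = D / N * (N * x - 1) := by
        field_simp
        ring
    _ ≤ 0 := mul_nonpos_of_nonneg_of_nonpos (by positivity) (by linarith)

theorem nonempty_plot_embedding (hab : a * b ≤ t) : Nonempty (Plot a b ↪ Fin t) :=
  Function.Embedding.nonempty_of_card_le (by simpa [mul_comm] using hab)

theorem IsCritical.isOptimalTriple_of_mul_le_one (h : IsCritical R x) (ha : 2 ≤ a) (hb : 2 ≤ b)
    (hab : a * b ≤ t) (hx : 0 < x) (hpx : a * b * x ≤ 1)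
    (hdeg : ∀ u v, R u v → (plotGraph a b).degree u + (plotGraph a b).degree v < a + b)
    (hpaired : ∀ e : Plot a b ↪ Fin t, RepeatsIn R (pairedArray e)) :
    IsOptimalTriple (1 : Matrix (Plot a b) (Plot a b) ℝ) x (distinctQ (plotGraph a b) t x)
      {s : BlockArray a b t | RepeatsIn R s} := by
  have : Nonempty (Plot a b) := ⟨⟨0, by omega⟩, ⟨0, by omega⟩⟩
  obtain ⟨e⟩ := nonempty_plot_embedding hab
  have hc₁ : 0 < c01 1 (pairedArray e) :=
    c01_one_pairedArray_pos ha hb e fun u v huv hs => hdeg u v (hpaired e u v huv hs)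
  have hc₁₁ : 0 ≤ c11 1 (pairedArray e) :=
    leadingCoeff_nonneg_of_quadratic_nonneg (q_one_nonneg (pairedArray e))
  exact h.isOptimalTriple (repeatsIn_distinctArray e R) (hpaired e)
    (c01_one_distinctArray_neg ha hb e).ne hc₁.ne' (slope_distinctArray_nonpos hx.le hpx e)
    (add_nonneg hc₁.le (mul_nonneg hc₁₁ hx.le))

theorem isCritical_of_degree (hx : 0 ≤ x) (hpx : a * b * x ≤ 2)
    (hadj : ∀ u v, R u v → Adjacent u v)
    (heq : ∀ u v, R u v →
      (1 + x * (plotGraph a b).degree u) * (1 + x * (plotGraph a b).degree v) = 2 * (a * b) * x)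
    (hlt : ∀ u v, Adjacent u v → ¬ R u v →
      2 * (a * b) * x < (1 + x * (plotGraph a b).degree u) * (1 + x * (plotGraph a b).degree v)) :
    IsCritical R x where
  eq_zero u v huv := by
    have : Nonempty (Plot a b) := ⟨u⟩
    have hcard : (Fintype.card (Plot a b) : ℝ) ≠ 0 := by exact_mod_cast Fintype.card_ne_zero
    rw [interferenceKernel_plotGraph_of_adjacent (hadj u v huv), heq u v huv, ← card_plot]
    field_simp
    ring
  neg u v hne huv := by
    by_cases hadj' : Adjacent u v
    · have hcard : (0 : ℝ) < Fintype.card (Plot a b) := by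
        exact_mod_cast Fintype.card_pos_iff.2 ⟨u⟩
      rw [interferenceKernel_plotGraph_of_adjacent hadj', sub_neg, lt_div_iff₀ hcard, card_plot]
      linarith [hlt u v hadj' huv]
    · exact interferenceKernel_apply_neg_of_not_adj hne (mt plotGraph_adj.1 hadj') hx
        (by rwa [card_plot])

end Critical

/-! ### The three block shapes -/

section Shapes

variable {a b t : ℕ} {x : ℝ}

theorem distinctQ_plotGraph (ha : 2 ≤ a) (hb : 2 ≤ b) (t : ℕ) (x : ℝ) :
    distinctQ (plotGraph a b) t x
      = (a * b - 1) + 2 * (-(4 * (a * b) - 2 * a - 2 * b) / (a * b)) * x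
        + (eta a b t - (16 * (a * b) - 14 * a - 14 * b + 8) / (a * b)) * x ^ 2 := by
  rw [distinctQ, card_plot, sum_degree_plotGraph ha hb, distinctC11_plotGraph ha hb]

theorem isCritical_significantPair (ha : 3 ≤ a) (hb : 3 ≤ b) (hx : 0 < x) (hpx : a * b * x ≤ 2)
    (hroot : (1 + x * 2) * (1 + x * 3) = 2 * (a * b) * x) :
    IsCritical (SignificantPair (a := a) (b := b)) x := by
  refine isCritical_of_degree hx.le hpx (fun u v h => h.1) ?_ ?_
  · rintro u v ⟨huv, hu | hv⟩
    · rw [(isCorner_iff_degree_eq_two (by omega) (by omega)).1 hu, huv.degree_eq_three ha hb hu]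
      exact_mod_cast hroot
    · rw [(isCorner_iff_degree_eq_two (by omega) (by omega)).1 hv,
        huv.symm.degree_eq_three ha hb hv, mul_comm (1 + _)]
      exact_mod_cast hroot
  · intro u v huv hR
    obtain ⟨hu, hv⟩ := not_or.1 fun h => hR ⟨huv, h⟩
    have hdu := three_le_degree_plotGraph (by omega) (by omega) hu
    have hdv := three_le_degree_plotGraph (by omega) (by omega) hv
    calc 2 * (a * b) * x = (1 + x * 2) * (1 + x * 3) := hroot.symm
      _ < (1 + x * (3 : ℕ)) * (1 + x * (3 : ℕ)) := by
        push_cast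
        gcongr
        norm_num
      _ ≤ _ := by gcongr

theorem isCritical_strictlySignificantPair (ha : 2 ≤ a) (hb : 2 ≤ b) (hx : 0 < x)
    (hpx : a * b * x ≤ 2) (hroot : (1 + x * 2) ^ 2 = 2 * (a * b) * x) :
    IsCritical (StrictlySignificantPair (a := a) (b := b)) x := by
  have hlt : (1 + x * 2) * (1 + x * 2) < (1 + x * 2) * (1 + x * 3) := by
    gcongr
    norm_num
  refine isCritical_of_degree hx.le hpx (fun u v h => h.1) ?_ ?_
  · rintro u v ⟨-, hu, hv⟩
    rw [(isCorner_iff_degree_eq_two ha hb).1 hu, (isCorner_iff_degree_eq_two ha hb).1 hv, ← hroot]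
    push_cast
    ring
  · intro u v huv hR
    rw [← hroot, sq]
    have hu : (2 : ℝ) ≤ (plotGraph a b).degree u := by
      exact_mod_cast two_le_degree_plotGraph ha hb u
    have hv : (2 : ℝ) ≤ (plotGraph a b).degree v := by
      exact_mod_cast two_le_degree_plotGraph ha hb v
    refine hlt.trans_le ?_
    by_cases hcu : IsCorner u
    · have hv3 : (3 : ℝ) ≤ (plotGraph a b).degree v := by
        exact_mod_cast three_le_degree_plotGraph ha hb fun hcv => hR ⟨huv, hcu, hcv⟩
      gcongr
    · have hu3 : (3 : ℝ) ≤ (plotGraph a b).degree u := by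
        exact_mod_cast three_le_degree_plotGraph ha hb hcu
      rw [mul_comm]
      gcongr

theorem isOptimalTriple_of_three_le (ha : 3 ≤ a) (hb : 3 ≤ b) (hab : a * b ≤ t)
    (hx : x = smallerRoot 6 (2 * (a * b) - 5) 1) :
    IsOptimalTriple (1 : Matrix (Plot a b) (Plot a b) ℝ) x
      (a * b - (a * b + 2) / (a * b) + 2 * ((2 * a + 2 * b - 5) / (a * b) - 2) * x
        + (eta a b t - (16 * (a * b) - 14 * a - 14 * b + 20) / (a * b)) * x ^ 2)
      {s : BlockArray a b t | RepeatsIn SignificantPair s} := by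
  have hp : (9 : ℝ) ≤ a * b := by exact_mod_cast Nat.mul_le_mul ha hb
  have hz := quadratic_inv_nonpos_of_six_le (by linarith : (6 : ℝ) ≤ a * b)
  have hx0 : 0 < x := hx ▸ smallerRoot_pos (by norm_num) (by linarith) one_pos
  have hpx : a * b * x ≤ 1 := by
    rw [← le_div_iff₀' (by linarith), one_div, hx]
    exact smallerRoot_le (by norm_num) hz
  have hroot : 6 * x ^ 2 - (2 * (a * b) - 5) * x + 1 = 0 :=
    hx ▸ quadratic_smallerRoot (by norm_num) hz
  have hcrit : IsCritical (SignificantPair (a := a) (b := b)) x :=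
    isCritical_significantPair ha hb hx0 (by linarith) (by linear_combination hroot)
  convert hcrit.isOptimalTriple_of_mul_le_one (by omega) (by omega) hab hx0 hpx ?_
    repeatsIn_pairedArray using 1
  · rw [distinctQ_plotGraph (by omega) (by omega)]
    have ha0 : (a : ℝ) ≠ 0 := by positivity
    have hb0 : (b : ℝ) ≠ 0 := by positivity
    field_simp
    linear_combination -2 * hroot
  · rintro u v ⟨huv, hu | hv⟩
    · rw [(isCorner_iff_degree_eq_two (by omega) (by omega)).1 hu, huv.degree_eq_three ha hb hu]
      omega
    · rw [(isCorner_iff_degree_eq_two (by omega) (by omega)).1 hv,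
        huv.symm.degree_eq_three ha hb hv]
      omega

theorem isOptimalTriple_two_rows (hb : 3 ≤ b) (hbt : 2 * b ≤ t)
    (hx : x = smallerRoot 1 (b - 1) (1 / 4)) :
    IsOptimalTriple (1 : Matrix (Plot 2 b) (Plot 2 b) ℝ) x
      (2 * b - 1 + (4 / b - 6) * x + (eta 2 b t - 9 + 10 / b) * x ^ 2)
      {s : BlockArray 2 b t | RepeatsIn StrictlySignificantPair s} := by
  have hb3 : (3 : ℝ) ≤ b := by exact_mod_cast hb
  have hz := quadratic_inv_nonpos_of_three_le hb3
  have hx0 : 0 < x := hx ▸ smallerRoot_pos one_pos (by linarith) (by norm_num)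
  have hpx : ((2 : ℕ) : ℝ) * b * x ≤ 1 := by
    rw [← le_div_iff₀' (by positivity), one_div, hx]
    exact smallerRoot_le one_pos (by exact_mod_cast hz)
  have hroot : 1 * x ^ 2 - (b - 1) * x + 1 / 4 = 0 := hx ▸ quadratic_smallerRoot one_pos hz
  have hcrit : IsCritical (StrictlySignificantPair (a := 2) (b := b)) x :=
    isCritical_strictlySignificantPair le_rfl (by omega) hx0 (by linarith)
      (by push_cast; linear_combination 4 * hroot)
  convert hcrit.isOptimalTriple_of_mul_le_one le_rfl (by omega) hbt hx0 hpx ?_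
    repeatsIn_pairedArray_of_two_rows using 1
  · rw [distinctQ_plotGraph le_rfl (by omega)]
    have hb0 : (b : ℝ) ≠ 0 := by positivity
    push_cast
    field_simp
    ring
  · rintro u v ⟨-, hu, hv⟩
    rw [(isCorner_iff_degree_eq_two le_rfl (by omega)).1 hu,
      (isCorner_iff_degree_eq_two le_rfl (by omega)).1 hv]
    omega

theorem isOptimalTriple_two_two (ht : 4 ≤ t) :
    IsOptimalTriple (1 : Matrix (Plot 2 2) (Plot 2 2) ℝ) (1 / 2) 2
      {s : BlockArray 2 2 t | RepeatsIn StrictlySignificantPair s} := by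
  have hcrit : IsCritical (StrictlySignificantPair (a := 2) (b := 2)) (1 / 2) :=
    isCritical_strictlySignificantPair le_rfl le_rfl (by norm_num) (by norm_num) (by norm_num)
  obtain ⟨e⟩ : Nonempty (Plot 2 2 ↪ Fin t) := nonempty_plot_embedding ht
  have hc11 : distinctC11 (plotGraph 2 2) t = 4 := by
    rw [distinctC11_plotGraph le_rfl le_rfl, eta]
    push_cast
    ring
  have hslope : c01 1 (distinctArray e) + c11 1 (distinctArray e) * (1 / 2) = 0 := by
    rw [c01_one_distinctArray, c11_one_distinctArray, hc11, card_plot,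
      sum_degree_plotGraph le_rfl le_rfl]
    norm_num
  have hdistinct := repeatsIn_distinctArray e StrictlySignificantPair
  have hc01 := (c01_one_distinctArray_neg le_rfl le_rfl e).ne
  convert hcrit.isOptimalTriple hdistinct hdistinct hc01 hc01 hslope.le hslope.ge using 1
  rw [distinctQ, hc11, card_plot, sum_degree_plotGraph le_rfl le_rfl]
  norm_num

end Shapes

end Interference

end

theorem mainTheorem9 (a b t p : ℕ) (hab : a ≤ b) (hp : p = a * b) (ht : p ≤ t) :
    (3 ≤ a → ∀ x : ℝ, x = ((2 * p - 5) - √((2 * (p : ℝ) - 5) ^ 2 - 24)) / 12 →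
      Irrational x ∧
      Interference.IsOptimalTriple (1 : Matrix (Interference.Plot a b) (Interference.Plot a b) ℝ)
        x
        (p - (p + 2) / p + 2 * ((2 * a + 2 * b - 5) / p - 2) * x
          + (Interference.eta a b t - (16 * p - 14 * a - 14 * b + 20) / p) * x ^ 2)
        (⋃ i ∈ Finset.range 5, Interference.QSet a b t i)) ∧
    (a = 2 → 3 ≤ b → ∀ x : ℝ, x = (b - 1 - √(((b : ℝ) - 1) ^ 2 - 1)) / 2 →
      Interference.IsOptimalTriple (1 : Matrix (Interference.Plot a b) (Interference.Plot a b) ℝ)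
        x
        (2 * b - 1 + (4 / b - 6) * x + (Interference.eta a b t - 9 + 10 / b) * x ^ 2)
        (Interference.QSet a b t 0 ∪ Interference.QStarSet a b t 1
          ∪ Interference.QStarSet a b t 2)) ∧
    (a = 2 → b = 2 →
      Interference.IsOptimalTriple (1 : Matrix (Interference.Plot a b) (Interference.Plot a b) ℝ)
        (1 / 2) 2
        (Interference.QSet a b t 0 ∪ Interference.QStarSet a b t 1
          ∪ Interference.QStarSet a b t 2)) := by
  subst hp
  refine ⟨fun ha x hx => ?_, fun ha hb x hx => ?_, fun ha hb => ?_⟩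
  · have hb : 3 ≤ b := ha.trans hab
    have hroot : x = Interference.smallerRoot 6 (2 * (a * b : ℕ) - 5) 1 := by
      rw [hx, Interference.smallerRoot]
      norm_num
    refine ⟨hroot ▸ Interference.irrational_smallerRoot_of_nine_le (Nat.mul_le_mul ha hb), ?_⟩
    rw [Interference.iUnion_QSet_eq]
    push_cast at hroot ⊢
    exact Interference.isOptimalTriple_of_three_le ha hb ht hroot
  · subst ha
    rw [Interference.QSet_union_QStarSet_eq]
    refine Interference.isOptimalTriple_two_rows hb ht ?_
    rw [hx, Interference.smallerRoot]
    norm_num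
  · subst ha hb
    rw [Interference.QSet_union_QStarSet_eq]
    exact Interference.isOptimalTriple_two_two ht
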